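/- Let $n,m\in\mathbb N$, let $a:\mathbb R^n\to\mathbb R^m$ and $b:\mathbb R^n\to\mathbb R$ be affine, let $\mu\in\mathbb R^m$, and let $\Sigma\in\mathbb R^{m\times m}$ be symmetric positive definite. On $\mathbb R^m$ use the norm $\|v\|:=\|\Sigma^{-1/2}v\|_2$. For probability distributions $\mathbb P_1,\mathbb P_2$ on $\mathbb R^m$ let $$d_W(\mathbb P_1,\mathbb P_2):=\inf_{\pi}\ \mathbb E_{(X_1,X_2)\sim\pi}\big[\|X_1-X_2\|\big]\in[0,\infty],$$ where $\pi$ ranges over all couplings of $\mathbb P_1$ and $\mathbb P_2$, i.e. probability distributions on $\mathbb R^m\times\mathbb R^m$ with marginals $\mathbb P_1$ and $\mathbb P_2$. Let $\mathbb P=N(\mu,\Sigma)$ be the Gaussian distribution with mean $\mu$ and covariance matrix $\Sigma$, let $\delta>0$, $\epsilon\in(0,\tfrac12]$, and let $$\mathcal P:=\{\mathbb Q \text{ a probability distribution on } \mathbb R^m:\ d_W(\mathbb Q,\mathbb P)\le\delta\}.$$ For an integrable real random variable $Y$ and $\alpha\in(0,1)$ let $$\mathrm{CVaR}_{\alpha}(Y):=\min_{\gamma\in\mathbb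 R}\Big\{\gamma+\tfrac1{1-\alpha}\,\mathbb E\big[\max\{Y-\gamma,0\}\big]\Big\}.$$ Let $Y$ be a standard one-dimensional Gaussian random variable and put $$c_p:=\inf_{\epsilon'\in(0,\epsilon)}\frac{\delta+\epsilon\,\mathrm{CVaR}_{1-\epsilon}(Y)-\epsilon'\,\mathrm{CVaR}_{1-\epsilon'}(Y)}{\epsilon-\epsilon'}.$$ Then this infimum is finite, $c_p\ge 0$, and $$\Big\{x\in\mathbb R^n:\ \inf_{\mathbb Q\in\mathcal P}\mathbb Q\big[\{\xi\in\mathbb R^m:\ a(x)^{\top}\xi\le b(x)\}\big]\ge 1-\epsilon\Big\}=\Big\{x\in\mathbb R^n:\ a(x)^{\top}\mu+c_p\,\big\|\Sigma^{1/2}a(x)\big\|_2\le b(x)\Big\}.$$ -/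

import Mathlib

open MeasureTheory ProbabilityTheory
open scoped MatrixOrder ENNReal

noncomputable section

namespace DRCC

/-- Conditional value-at-risk at level `α` of a real random variable with law `ν`,
`CVaR_α = min_γ { γ + (1 - α)⁻¹ 𝔼[(Y - γ)⁺] }`. -/
def cvar (α : ℝ) (ν : Measure ℝ) : ℝ :=
  ⨅ γ : ℝ, γ + (1 - α)⁻¹ * ∫ y, max (y - γ) 0 ∂ν

/-- For an integrable law the infimum defining `cvar` is over a set that is bounded below, so it is
a genuine infimum. -/
theorem bddBelow_cvar {α : ℝ} (h0 : 0 ≤ α) (h1 : α < 1) (ν : Measure ℝ) [IsProbabilityMeasure ν]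
    (hν : Integrable (fun y : ℝ => y) ν) :
    BddBelow (Set.range fun γ : ℝ => γ + (1 - α)⁻¹ * ∫ y, max (y - γ) 0 ∂ν) := by
  refine ⟨∫ y, y ∂ν, ?_⟩
  rintro _ ⟨γ, rfl⟩
  have hsub : Integrable (fun y : ℝ => y - γ) ν := hν.sub (integrable_const γ)
  have h2 : ∫ y, (y - γ) ∂ν ≤ ∫ y, max (y - γ) 0 ∂ν :=
    integral_mono hsub hsub.pos_part fun y => le_max_left _ _
  have h3 : ∫ y, (y - γ) ∂ν = (∫ y, y ∂ν) - γ := by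
    rw [integral_sub hν (integrable_const γ)]; simp
  have h4 : 0 ≤ ∫ y, max (y - γ) 0 ∂ν := integral_nonneg fun y => le_max_right _ _
  have h5 : 1 ≤ (1 - α)⁻¹ := (one_le_inv₀ (by linarith)).2 (by linarith)
  have h6 := mul_le_mul_of_nonneg_right h5 h4
  simp only
  linarith

section Wasserstein

variable {E : Type*} [AddCommGroup E] [MeasurableSpace E]

/-- `π` is a coupling of `P₁` and `P₂`: a joint law with marginals `P₁` and `P₂`. -/
def IsCoupling (π : Measure (E × E)) (P₁ P₂ : Measure E) : Prop :=
  π.fst = P₁ ∧ π.snd = P₂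

/-- The Wasserstein distance of two probability distributions with respect to the norm `N`
(a value in `[0, ∞]`): the infimum over all couplings of the expected transport distance. -/
def wassersteinDist (N : E → ℝ) (P₁ P₂ : Measure E) : ℝ≥0∞ :=
  ⨅ (π : Measure (E × E)) (_ : IsCoupling π P₁ P₂), ∫⁻ z, ENNReal.ofReal (N (z.1 - z.2)) ∂π

/-- The Wasserstein ball of radius `δ` around the reference distribution `P`, among all
probability distributions. -/
def wassersteinBall (N : E → ℝ) (P : Measure E) (δ : ℝ) : Set (ProbabilityMeasure E) :=
  {Q | wassersteinDist N (Q : Measure E) P ≤ ENNReal.ofReal δ}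

end Wasserstein

/-- The norm `v ↦ ‖S^{-1/2} v‖₂` on `ℝᵐ`. -/
def whitenedNorm {m : ℕ} (S : Matrix (Fin m) (Fin m) ℝ) (v : EuclideanSpace ℝ (Fin m)) : ℝ :=
  ‖Matrix.toEuclideanCLM (𝕜 := ℝ) (CFC.sqrt S)⁻¹ v‖

/-- Feasible region of the individual pessimistic chance constraint
`inf_{Q ∈ ball} Q[a(x)ᵀ ξ ≤ b(x)] ≥ 1 - ε` over an ambiguity set `ball`. -/
def pessFeasible {n m : ℕ} (ball : Set (ProbabilityMeasure (EuclideanSpace ℝ (Fin m))))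
    (a : EuclideanSpace ℝ (Fin n) →ᵃ[ℝ] EuclideanSpace ℝ (Fin m))
    (b : EuclideanSpace ℝ (Fin n) →ᵃ[ℝ] ℝ) (ε : ℝ) : Set (EuclideanSpace ℝ (Fin n)) :=
  {x | ENNReal.ofReal (1 - ε) ≤
    ⨅ Q ∈ ball, (Q : Measure (EuclideanSpace ℝ (Fin m))) {ξ | inner ℝ (a x) ξ ≤ b x}}

/-- The values
`(δ + ε CVaR_{1-ε}(Y) - ε' CVaR_{1-ε'}(Y)) / (ε - ε')`, `ε' ∈ (0, ε)`, for `Y` standard normal. -/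
def pessRatios (δ ε : ℝ) : Set ℝ :=
  (fun ε' : ℝ => (δ + ε * cvar (1 - ε) (gaussianReal 0 1)
    - ε' * cvar (1 - ε') (gaussianReal 0 1)) / (ε - ε')) '' Set.Ioo 0 ε

/-- The constant `c_p`, the infimum of `pessRatios`. -/
def pessConst (δ ε : ℝ) : ℝ := sInf (pessRatios δ ε)

end DRCC

end

/-! Fix `x`, put `w = a x`, `s = ‖Σ^{1/2} w‖`, and suppose `s ≠ 0`. Then `Y ξ = ⟪w, ξ - μ⟫ / s` is
standard normal under `P`, 1-Lipschitz for the whitened norm, and grows at unit rate along a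
direction `u` of norm one. The constraint becomes `Q[Y > c] ≤ ε` on the ball, with `c = (b x - ⟪w,
μ⟫) / s`, and the claim is that this holds iff `c_p ≤ c` (`forall_mem_ball_iff`). Write `e γ = 𝔼[(Y
- γ)⁺]`, so that `ε CVaR_{1-ε} = inf_γ (ε γ + e γ)`. Both directions rest on the quantity `(c - γ) q
- e γ + e c`. By weak duality it bounds from below the cost of any coupling giving `{Y > c}` mass
`q` (`le_of_isCoupling`). For `q = ℙ[Y > γ]` it is exactly the cost of pushing the mass on `γ < Y ≤
c` up to level `c` along `u` (`exists_push`). Comparing it with `δ` yields the ratios defining `c_p`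
(`exists_multiplier`, `exists_threshold`). -/

namespace DRCC

open Set Filter Topology

/-! ### Excess and tail expectation of the standard normal law -/

/-- The expected excess `𝔼[(Y - γ)⁺]` of a standard normal variable over `γ`. -/
noncomputable def excess (γ : ℝ) : ℝ := ∫ y, max (y - γ) 0 ∂gaussianReal 0 1

/-- The tail probability `ℙ[Y > t]` of a standard normal variable. -/
noncomputable def tail (t : ℝ) : ℝ := (gaussianReal 0 1).real (Ioi t)

/-- The tail expectation `ε CVaR_{1-ε}(Y)` of a standard normal variable. -/
noncomputable def tailExp (ε : ℝ) : ℝ := ε * cvar (1 - ε) (gaussianReal 0 1)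

theorem integrable_id_gaussian : Integrable (fun y : ℝ => y) (gaussianReal 0 1) :=
  (memLp_id_gaussianReal (μ := 0) (v := 1) 1).integrable le_rfl

theorem integrable_excess (γ : ℝ) :
    Integrable (fun y : ℝ => max (y - γ) 0) (gaussianReal 0 1) :=
  (integrable_id_gaussian.sub (integrable_const γ)).pos_part

theorem excess_antitone : Antitone excess := fun γ γ' h =>
  integral_mono (integrable_excess _) (integrable_excess _) fun y =>
    max_le_max (by linarith) le_rfl

theorem tailExp_le {ε : ℝ} (h0 : 0 < ε) (h1 : ε ≤ 1) (γ : ℝ) :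
    tailExp ε ≤ ε * γ + excess γ := by
  have h := ciInf_le (bddBelow_cvar (α := 1 - ε) (by linarith) (by linarith) (gaussianReal 0 1)
    integrable_id_gaussian) γ
  have h2 := mul_le_mul_of_nonneg_left h h0.le
  simp only [sub_sub_cancel] at h2
  rw [mul_add, mul_inv_cancel_left₀ h0.ne'] at h2
  simpa [tailExp, cvar, excess] using h2

theorem le_tailExp {ε k : ℝ} (h0 : 0 < ε) (h : ∀ γ, k ≤ ε * γ + excess γ) : k ≤ tailExp ε := by
  have : ε⁻¹ * k ≤ cvar (1 - ε) (gaussianReal 0 1) := by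
    refine le_ciInf fun γ => ?_
    have h2 := mul_le_mul_of_nonneg_left (h γ) (inv_pos.2 h0).le
    rw [mul_add, inv_mul_cancel_left₀ h0.ne'] at h2
    simpa [excess] using h2
  have h2 := mul_le_mul_of_nonneg_left this h0.le
  rwa [mul_inv_cancel_left₀ h0.ne'] at h2

theorem exists_lt_of_tailExp_lt {ε k : ℝ} (h0 : 0 < ε) (h : tailExp ε < k) :
    ∃ γ, ε * γ + excess γ < k := by
  by_contra! hc
  exact absurd (le_tailExp h0 hc) (not_le.2 h)

theorem excess_sub_excess_neg (g : ℝ) : excess (-g) - excess g = g := by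
  have h : excess g = ∫ y, max (-y - g) 0 ∂gaussianReal 0 1 := by
    have h1 := gaussianReal_map_neg (μ := 0) (v := 1)
    rw [neg_zero] at h1
    unfold excess
    conv_lhs => rw [← h1]
    rw [integral_map (by fun_prop) (by fun_prop)]
  have hi : Integrable (fun y : ℝ => max (-y - g) 0) (gaussianReal 0 1) :=
    (integrable_id_gaussian.neg.sub (integrable_const g)).pos_part
  rw [h, excess, ← integral_sub (integrable_excess _) hi]
  have h2 : ∀ y : ℝ, max (y - -g) 0 - max (-y - g) 0 = y + g := by
    intro y
    rcases le_total 0 (y + g) with h | h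
    · rw [max_eq_left (by linarith), max_eq_right (by linarith)]; ring
    · rw [max_eq_right (by linarith), max_eq_left (by linarith)]; ring
  simp_rw [h2]
  rw [integral_add integrable_id_gaussian (integrable_const g)]
  simp

/-- Symmetry gives `e γ - e (-γ) = -γ` and convexity gives `2 e 0 ≤ e γ + e (-γ)`, hence `e γ ≥ e 0
- γ / 2`. This is where `ε ≤ 1/2` matters: negative `γ` cannot beat `γ = 0` in the infimum. -/
theorem excess_zero_le {ε γ : ℝ} (hε : ε ≤ 1 / 2) (hγ : γ ≤ 0) :
    excess 0 ≤ ε * γ + excess γ := by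
  have h1 := excess_sub_excess_neg (-γ)
  rw [neg_neg] at h1
  have h2 : 2 * excess 0 ≤ excess γ + excess (-γ) := by
    unfold excess
    rw [← integral_const_mul, ← integral_add (integrable_excess _) (integrable_excess _)]
    refine integral_mono ((integrable_excess _).const_mul _)
      ((integrable_excess _).add (integrable_excess _)) fun y => ?_
    have a1 := le_max_left (y - γ) 0
    have a2 := le_max_right (y - γ) 0
    have a3 := le_max_left (y - -γ) 0
    have a4 := le_max_right (y - -γ) 0
    have : max (y - 0) 0 ≤ (max (y - γ) 0 + max (y - -γ) 0) / 2 :=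
      max_le (by linarith) (by linarith)
    simp only
    linarith
  nlinarith

/-- For `γ ≥ 0` the objective `ε γ + e γ` increases with `ε`; negative `γ` is dominated by `γ = 0`,
where the objective does not depend on `ε`. This makes the numerators in `c_p` positive. -/
theorem tailExp_mono {ε ε' : ℝ} (h0 : 0 < ε') (h : ε' ≤ ε) (hε : ε ≤ 1 / 2) :
    tailExp ε' ≤ tailExp ε := by
  refine le_tailExp (h0.trans_le h) fun γ => ?_
  rcases le_total 0 γ with hγ | hγ
  · exact (tailExp_le h0 (by linarith) γ).trans (by gcongr)
  · refine le_trans ?_ (excess_zero_le hε hγ)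
    simpa using tailExp_le h0 (by linarith) 0

theorem pessRatios_nonneg {δ ε : ℝ} (hδ : 0 < δ) (hε : ε ≤ 1 / 2) :
    ∀ r ∈ pessRatios δ ε, 0 ≤ r := by
  rintro _ ⟨ε', ⟨h0, h1⟩, rfl⟩
  have := tailExp_mono h0 h1.le hε
  unfold tailExp at this
  exact div_nonneg (by linarith) (by linarith)

theorem pessRatios_nonempty (δ : ℝ) {ε : ℝ} (hε : 0 < ε) : (pessRatios δ ε).Nonempty :=
  (nonempty_Ioo.2 hε).image _

theorem isGLB_pessConst {δ ε : ℝ} (hδ : 0 < δ) (h0 : 0 < ε) (hε : ε ≤ 1 / 2) :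
    IsGLB (pessRatios δ ε) (pessConst δ ε) :=
  isGLB_csInf (pessRatios_nonempty δ h0) ⟨0, pessRatios_nonneg hδ hε⟩

theorem pessConst_nonneg {δ ε : ℝ} (hδ : 0 < δ) (h0 : 0 < ε) (hε : ε ≤ 1 / 2) :
    0 ≤ pessConst δ ε :=
  le_csInf (pessRatios_nonempty δ h0) (pessRatios_nonneg hδ hε)

/-! ### Tail probabilities and quantiles -/

theorem tail_eq_one_sub_cdf (t : ℝ) : tail t = 1 - cdf (gaussianReal 0 1) t := by
  rw [cdf_eq_real, tail, ← compl_Iic, probReal_compl_eq_one_sub measurableSet_Iic]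

theorem tail_strictAnti : StrictAnti tail := by
  intro s t hst
  have hpos : 0 < (gaussianReal 0 1).real (Ioc s t) := by
    rw [measureReal_def, ENNReal.toReal_pos_iff]
    refine ⟨pos_iff_ne_zero.2 fun h => ?_, measure_lt_top _ _⟩
    have h2 := gaussianReal_absolutelyContinuous' 0 (one_ne_zero (α := NNReal)) h
    rw [Real.volume_Ioc, ENNReal.ofReal_eq_zero] at h2
    linarith
  have := measureReal_union (μ := gaussianReal 0 1) (Ioc_disjoint_Ioi (le_refl t) (a := s))
    measurableSet_Ioi
  rw [Ioc_union_Ioi_eq_Ioi hst.le] at this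
  unfold tail
  linarith

theorem tail_continuous : Continuous tail := by
  have : Continuous (cdf (gaussianReal 0 1)) := by
    rw [continuous_iff_continuousAt]
    intro x
    rw [(monotone_cdf _).continuousAt_iff_leftLim_eq_rightLim, StieltjesFunction.rightLim_eq]
    have h := (cdf (gaussianReal 0 1)).measure_singleton x
    rw [measure_cdf] at h
    have := nullSingletonClass_gaussianReal (μ := 0) (v := 1) one_ne_zero
    rw [measure_singleton, eq_comm, ENNReal.ofReal_eq_zero] at h
    exact le_antisymm ((monotone_cdf _).leftLim_le le_rfl) (by linarith)
  simp_rw [funext tail_eq_one_sub_cdf]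
  fun_prop

theorem tail_pos (t : ℝ) : 0 < tail t :=
  (measureReal_nonneg (s := Ioi (t + 1))).trans_lt (tail_strictAnti (lt_add_one t))

theorem exists_tail_eq {ε : ℝ} (h0 : 0 < ε) (h1 : ε < 1) : ∃ γ, tail γ = ε := by
  have ht : Tendsto tail atTop (𝓝 0) := by
    simp_rw [funext tail_eq_one_sub_cdf]
    simpa using (tendsto_cdf_atTop (gaussianReal 0 1)).const_sub 1
  have hb : Tendsto tail atBot (𝓝 1) := by
    simp_rw [funext tail_eq_one_sub_cdf]
    simpa using (tendsto_cdf_atBot (gaussianReal 0 1)).const_sub 1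
  exact mem_range_of_exists_le_of_exists_ge tail_continuous
    ((ht.eventually_lt_const h0).exists.imp fun _ => le_of_lt)
    ((hb.eventually_const_lt h1).exists.imp fun _ => le_of_lt)

/-- The excess functional is convex with subgradient `-tail c` at `c`. -/
theorem tailExp_tail (c : ℝ) : tail c * c + excess c ≤ tailExp (tail c) := by
  refine le_tailExp (tail_pos c) fun γ => ?_
  have hi : Integrable ((Ioi c).indicator fun _ : ℝ => c - γ) (gaussianReal 0 1) :=
    (integrable_const _).indicator measurableSet_Ioi
  have h : ∫ y, (max (y - c) 0 + (Ioi c).indicator (fun _ => c - γ) y) ∂gaussianReal 0 1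
      ≤ excess γ := by
    refine integral_mono ((integrable_excess c).add hi) (integrable_excess γ) fun y => ?_
    by_cases hy : y ∈ Ioi c
    · have := mem_Ioi.1 hy
      simp only [indicator_of_mem hy]
      rw [max_eq_left (by linarith)]
      exact le_trans (by linarith) (le_max_left _ _)
    · have := not_lt.1 (mt mem_Ioi.2 hy)
      simp only [indicator_of_notMem hy]
      rw [max_eq_right (by linarith)]
      simp
  rw [integral_add (integrable_excess c) hi, integral_indicator_const _ measurableSet_Ioi] at h
  simp only [smul_eq_mul] at h
  change excess c + tail c * (c - γ) ≤ _ at h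
  linarith

/-- The cost of moving the mass of the standard normal law on `(γ, c]` to `c`. -/
theorem integral_transport {γ c : ℝ} (h : γ ≤ c) :
    Integrable ((Ioc γ c).indicator fun y => c - y) (gaussianReal 0 1) ∧
    ∫ y, (Ioc γ c).indicator (fun y => c - y) y ∂gaussianReal 0 1 =
      (c - γ) * tail γ - excess γ + excess c := by
  have hi : Integrable ((Ioi γ).indicator fun _ : ℝ => c - γ) (gaussianReal 0 1) :=
    (integrable_const _).indicator measurableSet_Ioi
  refine ⟨((integrable_const _).sub integrable_id_gaussian).indicator measurableSet_Ioc, ?_⟩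
  have h1 : ∀ y, (Ioc γ c).indicator (fun y => c - y) y =
      (Ioi γ).indicator (fun _ => c - γ) y - max (y - γ) 0 + max (y - c) 0 := by
    intro y
    simp only [indicator_apply, mem_Ioc, mem_Ioi]
    rcases le_or_gt y γ with h1 | h1
    · rw [max_eq_right (by linarith), max_eq_right (by linarith)]
      simp [h1.not_gt]
    · rcases le_or_gt y c with h2 | h2
      · rw [max_eq_left (by linarith), max_eq_right (by linarith)]
        simp [h1, h2]
      · rw [max_eq_left (by linarith), max_eq_left (by linarith)]
        simp [h1, h2.not_ge]
  simp_rw [h1]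
  rw [integral_add (by exact hi.sub (integrable_excess γ)) (integrable_excess c),
    integral_sub hi (integrable_excess γ), integral_indicator_const _ measurableSet_Ioi]
  simp only [smul_eq_mul, mul_comm (c - γ)]
  rfl

/-! ### Comparing transport cost with the radius -/

/-- Below `c_p` the budget `δ` suffices to lift more than `ε` of mass strictly above `c`. The level
`c'` exceeds `c` because the moved mass lands exactly on `c'`. -/
theorem exists_threshold {δ ε c : ℝ} (hδ : 0 < δ) (h0 : 0 < ε) (hε : ε ≤ 1 / 2)
    (hc : c < pessConst δ ε) :
    ∃ γ c', γ ≤ c' ∧ c < c' ∧ ε < tail γ ∧ (c' - γ) * tail γ - excess γ + excess c' ≤ δ := by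
  obtain ⟨c', hcc', hc'⟩ := exists_between hc
  obtain ⟨q, hq⟩ := exists_tail_eq h0 (by linarith : ε < 1)
  rcases lt_or_ge c' q with h | h
  -- Here the normal law already has tail above `ε` at `c'`, so nothing is moved.
  · exact ⟨c', c', le_rfl, hcc', hq ▸ tail_strictAnti h, by simpa using hδ.le⟩
  have hcost : (c' - q) * tail q - excess q + excess c' < δ := by
    rcases h.eq_or_lt with rfl | h
    · simpa using hδ
    have h1 : tail c' < ε := hq ▸ tail_strictAnti h
    -- The ratio at `ε' = tail c'` exceeds `c'`; `c'` is optimal for this `ε'`, and `q` is a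
    -- competitor for `ε`.
    have h2 := (isGLB_pessConst hδ h0 hε).1 ⟨tail c', ⟨tail_pos c', h1⟩, rfl⟩
    have h3 := hc'.trans_le h2
    rw [lt_div_iff₀ (by linarith)] at h3
    have h4 := tailExp_tail c'
    have h5 := tailExp_le h0 (by linarith) q
    unfold tailExp at h4 h5
    rw [hq]
    linarith
  -- The strict cost bound leaves room to lower `γ` slightly below `q`, making the tail exceed `ε`.
  -- The term `excess q` stays frozen, since monotonicity of the excess handles it afterwards.
  have hcont : Continuous fun γ => (c' - γ) * tail γ - excess q + excess c' := by
    have := tail_continuous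
    fun_prop
  have hev := (hcont.continuousAt.eventually_lt_const hcost).filter_mono
    (nhdsWithin_le_nhds (s := Iio q))
  obtain ⟨γ, h1, h2⟩ := (hev.and self_mem_nhdsWithin).exists
  refine ⟨γ, c', (mem_Iio.1 h2).le.trans h, hcc', hq ▸ tail_strictAnti h2, ?_⟩
  have := excess_antitone (mem_Iio.1 h2).le
  linarith

/-- Above `c_p` some ratio is below `c`. A nearly optimal `γ` in the infimum for `ε` then makes the
dual bound at `q = ε` exceed `δ`; this bound increases with `q` because `γ < c`. -/
theorem exists_multiplier {δ ε c : ℝ} (hδ : 0 < δ) (h0 : 0 < ε) (hε : ε ≤ 1 / 2) (hc : pessConst δ ε < c) :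
    ∃ γ < c, ∀ q, (c - γ) * q - excess γ + excess c ≤ δ → q ≤ ε := by
  obtain ⟨_, ⟨ε', ⟨h1, h2⟩, rfl⟩, h3⟩ := exists_lt_of_csInf_lt (pessRatios_nonempty δ h0) hc
  rw [div_lt_iff₀ (by linarith)] at h3
  obtain ⟨γ, hγ⟩ := exists_lt_of_tailExp_lt h0
    (show tailExp ε < c * (ε - ε') - δ + tailExp ε' by unfold tailExp; linarith)
  have h4 := tailExp_le h1 (by linarith) γ
  have h5 := tailExp_le h1 (by linarith) c
  exact ⟨γ, by nlinarith, fun q hq => by nlinarith⟩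

/-! ### Transport bounds for a Lipschitz function with normal law -/

section Transport

variable {E : Type*} [AddCommGroup E] [MeasurableSpace E] {N Y : E → ℝ} {P : Measure E}

theorem wassersteinDist_le (N : E → ℝ) {π : Measure (E × E)} {P₁ P₂ : Measure E}
    (hπ : IsCoupling π P₁ P₂) :
    wassersteinDist N P₁ P₂ ≤ ∫⁻ z, ENNReal.ofReal (N (z.1 - z.2)) ∂π :=
  iInf₂_le π hπ

/-- Integrate the pointwise inequality `(c - γ) 1{Y z.1 > c} - (Y z.2 - γ)⁺ + (Y z.2 - c)⁺ ≤ N (z.1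
- z.2)`. When `Y z.1 > c`, its left side equals `c - max γ (Y z.2)` if `Y z.2 ≤ c` and `0`
otherwise, so the Lipschitz bound applies; when `Y z.1 ≤ c` it is nonpositive. -/
theorem le_of_isCoupling [MeasurableSub₂ E] (hN : Measurable N) (hN0 : ∀ v, 0 ≤ N v)
    (hY : Measurable Y) (hlip : ∀ v v', Y v - Y v' ≤ N (v - v'))
    (hP : P.map Y = gaussianReal 0 1) {Q : Measure E} [IsProbabilityMeasure Q]
    {π : Measure (E × E)} (hπ : IsCoupling π Q P) {γ c t : ℝ} (hγ : γ ≤ c) (ht : 0 ≤ t)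
    (hcost : ∫⁻ z, ENNReal.ofReal (N (z.1 - z.2)) ∂π ≤ ENNReal.ofReal t) :
    (c - γ) * Q.real {v | c < Y v} - excess γ + excess c ≤ t := by
  obtain ⟨h1, h2⟩ := hπ
  have : IsProbabilityMeasure π := by
    constructor
    rw [← Measure.fst_univ, h1, measure_univ]
  have hNm : Measurable fun z : E × E => N (z.1 - z.2) :=
    hN.comp (measurable_fst.sub measurable_snd)
  have hNi : Integrable (fun z : E × E => N (z.1 - z.2)) π :=
    ⟨hNm.aestronglyMeasurable, by
      rw [hasFiniteIntegral_iff_ofReal (Eventually.of_forall fun _ => hN0 _)]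
      exact hcost.trans_lt ENNReal.ofReal_lt_top⟩
  have hNint : ∫ z, N (z.1 - z.2) ∂π ≤ t := by
    rw [integral_eq_lintegral_of_nonneg_ae (Eventually.of_forall fun _ => hN0 _)
      hNm.aestronglyMeasurable]
    exact ENNReal.toReal_le_of_le_ofReal ht hcost
  have hmap : π.map (fun z => Y z.2) = gaussianReal 0 1 := by
    rw [← hP, ← h2, Measure.snd, Measure.map_map hY measurable_snd]
    rfl
  have hYm : Measurable fun z : E × E => Y z.2 := hY.comp measurable_snd
  have hei : ∀ g, Integrable (fun z : E × E => max (Y z.2 - g) 0) π := fun g => by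
    have := integrable_excess g
    rw [← hmap, integrable_map_measure (by fun_prop) hYm.aemeasurable] at this
    exact this
  have hee : ∀ g, ∫ z, max (Y z.2 - g) 0 ∂π = excess g := fun g => by
    rw [excess, ← hmap, integral_map hYm.aemeasurable (by fun_prop)]
  have hU : MeasurableSet {v | c < Y v} := measurableSet_lt measurable_const hY
  have hU2 : MeasurableSet {z : E × E | c < Y z.1} := measurable_fst hU
  have hUm : π.real {z | c < Y z.1} = Q.real {v | c < Y v} := by
    rw [measureReal_def, measureReal_def, ← h1, Measure.fst_apply hU]
    rfl
  have hii : Integrable ({z : E × E | c < Y z.1}.indicator fun _ => c - γ) π :=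
    (integrable_const _).indicator hU2
  have hmono : ∫ z, ({z : E × E | c < Y z.1}.indicator (fun _ => c - γ) z
      - max (Y z.2 - γ) 0 + max (Y z.2 - c) 0) ∂π ≤ ∫ z, N (z.1 - z.2) ∂π := by
    refine integral_mono ((hii.sub (hei γ)).add (hei c)) hNi fun z => ?_
    have hl := hlip z.1 z.2
    have h0 := hN0 (z.1 - z.2)
    simp only [indicator_apply, mem_ofPred_eq]
    rcases le_total (Y z.2) γ with h3 | h3
    · rw [max_eq_right (by linarith), max_eq_right (by linarith)]
      split_ifs <;> linarith
    · rw [max_eq_left (by linarith)]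
      rcases le_total (Y z.2) c with h4 | h4
      · rw [max_eq_right (by linarith)]
        split_ifs <;> linarith
      · rw [max_eq_left (by linarith)]
        split_ifs <;> linarith
  rw [integral_add (by exact hii.sub (hei γ)) (hei c), integral_sub hii (hei γ), hee, hee,
    integral_indicator_const _ hU2, hUm, smul_eq_mul] at hmono
  linarith

theorem real_le_of_mem_wassersteinBall [MeasurableSub₂ E] (hN : Measurable N) (hN0 : ∀ v, 0 ≤ N v)
    (hY : Measurable Y) (hlip : ∀ v v', Y v - Y v' ≤ N (v - v'))
    (hP : P.map Y = gaussianReal 0 1) {δ ε c : ℝ} (hδ : 0 < δ) (h0 : 0 < ε) (hε : ε ≤ 1 / 2)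
    (hc : pessConst δ ε ≤ c) {Q : ProbabilityMeasure E} (hQ : Q ∈ wassersteinBall N P δ) :
    (Q : Measure E).real {v | c < Y v} ≤ ε := by
  have key : ∀ c' > c, (Q : Measure E).real {v | c' < Y v} ≤ ε := by
    intro c' hc'
    obtain ⟨γ, hγ, h⟩ := exists_multiplier hδ h0 hε (hc.trans_lt hc')
    -- The infimum over couplings need not be attained, so the bound is shown for every budget `t >
    -- δ`.
    refine h _ (le_of_forall_gt_imp_ge_of_dense fun t ht => ?_)
    have h1 : wassersteinDist N (Q : Measure E) P < ENNReal.ofReal t :=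
      lt_of_le_of_lt hQ ((ENNReal.ofReal_lt_ofReal_iff (hδ.trans ht)).2 ht)
    simp only [wassersteinDist, iInf_lt_iff] at h1
    obtain ⟨π, hπ, h2⟩ := h1
    exact le_of_isCoupling hN hN0 hY hlip hP hπ hγ.le (hδ.trans ht).le h2.le
  -- The multiplier needs a level strictly above `c_p`; the level `c` follows by continuity from
  -- below along `u n ↓ c`.
  obtain ⟨u, hu, hu1, hu2⟩ := exists_seq_strictAnti_tendsto c
  have hUn : {v | c < Y v} = ⋃ n, {v | u n < Y v} := by
    ext v
    simp only [mem_ofPred_eq, mem_iUnion]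
    exact ⟨fun h => (hu2.eventually_lt_const h).exists, fun ⟨n, h⟩ => (hu1 n).trans h⟩
  have hm : Monotone fun n => {v | u n < Y v} := fun i j hij v hv =>
    (hu.antitone hij).trans_lt hv
  have ht := tendsto_measure_iUnion_atTop (μ := (Q : Measure E)) hm
  rw [← hUn] at ht
  have := (ENNReal.tendsto_toReal (measure_ne_top _ _)).comp ht
  exact le_of_tendsto' this fun n => key _ (hu1 n)

/-- The map `T` shifts each point with `γ < Y ≤ c'` along `u` until `Y = c'` and fixes all others.
The coupling carried by its graph has the stated cost, and all the mass with `Y > γ` ends at level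
at least `c' > c`. -/
theorem exists_push [IsProbabilityMeasure P] [MeasurableAdd₂ E] [Module ℝ E] [MeasurableSMul₂ ℝ E]
    (hNmeas : Measurable fun z : E × E => N (z.1 - z.2))
    (hY : Measurable Y) {u : E} (hNu : ∀ t, 0 ≤ t → N (t • u) = t)
    (hYu : ∀ v t, Y (v + t • u) = Y v + t)
    (hP : P.map Y = gaussianReal 0 1) {γ c c' : ℝ} (hγ : γ ≤ c') (hc : c < c') :
    ∃ Q : ProbabilityMeasure E, wassersteinDist N (Q : Measure E) P ≤
        ENNReal.ofReal ((c' - γ) * tail γ - excess γ + excess c') ∧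
      tail γ ≤ (Q : Measure E).real {v | c < Y v} := by
  set g : ℝ → ℝ := (Ioc γ c').indicator fun y => c' - y with hg
  have hgm : Measurable g := (measurable_const.sub measurable_id).indicator measurableSet_Ioc
  have hg0 : ∀ y, 0 ≤ g y := indicator_nonneg fun y hy => by linarith [hy.2]
  set T : E → E := fun v => v + g (Y v) • u with hT
  have hTm : Measurable T := measurable_id.add ((hgm.comp hY).smul measurable_const)
  have hU : MeasurableSet {v | c < Y v} := measurableSet_lt measurable_const hY
  have hTP : IsProbabilityMeasure (P.map T) := Measure.isProbabilityMeasure_map hTm.aemeasurable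
  refine ⟨⟨P.map T, hTP⟩, ?_, ?_⟩
  · have hπ : IsCoupling (P.map fun v => (T v, v)) (P.map T) P :=
      ⟨Measure.fst_map_prodMk measurable_id,
        (Measure.snd_map_prodMk hTm).trans Measure.map_id'⟩
    refine (wassersteinDist_le N hπ).trans ?_
    rw [lintegral_map hNmeas.ennreal_ofReal (hTm.prodMk measurable_id')]
    have h1 : ∀ v, N (T v - v) = g (Y v) := fun v => by
      rw [hT, add_sub_cancel_left, hNu _ (hg0 _)]
    simp_rw [h1]
    rw [← (integral_transport hγ).2, ofReal_integral_eq_lintegral_ofReal (integral_transport hγ).1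
      (Eventually.of_forall hg0), ← hP, lintegral_map hgm.ennreal_ofReal hY]
  · have hmap : tail γ = P.real {v | γ < Y v} := by
      rw [tail, ← hP, map_measureReal_apply hY measurableSet_Ioi]
      rfl
    rw [hmap]
    change _ ≤ (P.map T).real _
    rw [map_measureReal_apply hTm hU]
    refine measureReal_mono fun v hv => ?_
    simp only [mem_preimage, mem_ofPred_eq, hT, hYu] at hv ⊢
    by_cases h : Y v ≤ c'
    · rw [hg, indicator_of_mem (show Y v ∈ Ioc γ c' from ⟨hv, h⟩)]
      linarith
    · linarith [hg0 (Y v)]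

end Transport

theorem forall_mem_ball_iff {E : Type*} [AddCommGroup E] [MeasurableSpace E] {N Y : E → ℝ}
    {P : Measure E} [IsProbabilityMeasure P] [MeasurableAdd₂ E] [MeasurableSub₂ E] [Module ℝ E]
    [MeasurableSMul₂ ℝ E] (hN : Measurable N) (hN0 : ∀ v, 0 ≤ N v)
    (hY : Measurable Y) (hlip : ∀ v v', Y v - Y v' ≤ N (v - v'))
    {u : E} (hNu : ∀ t, 0 ≤ t → N (t • u) = t) (hYu : ∀ v t, Y (v + t • u) = Y v + t)
    (hP : P.map Y = gaussianReal 0 1) {δ ε c : ℝ} (hδ : 0 < δ) (h0 : 0 < ε) (hε : ε ≤ 1 / 2) :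
    (∀ Q ∈ wassersteinBall N P δ, (Q : Measure E).real {v | c < Y v} ≤ ε) ↔
      pessConst δ ε ≤ c := by
  refine ⟨fun h => ?_, fun h Q hQ =>
    real_le_of_mem_wassersteinBall hN hN0 hY hlip hP hδ h0 hε h hQ⟩
  by_contra! hc
  obtain ⟨γ, c', h1, h2, h3, h4⟩ := exists_threshold hδ h0 hε hc
  obtain ⟨Q, h5, h6⟩ := exists_push (hN.comp (measurable_fst.sub measurable_snd))
    hY hNu hYu hP h1 h2
  exact absurd (h Q (h5.trans (ENNReal.ofReal_le_ofReal h4))) (not_le.2 (h3.trans_le h6))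

theorem ofReal_le_iInf_iff {E : Type*} [MeasurableSpace E] {B : Set (ProbabilityMeasure E)}
    {Y : E → ℝ} (hY : Measurable Y) {ε c : ℝ} :
    ENNReal.ofReal (1 - ε) ≤ ⨅ Q ∈ B, (Q : Measure E) {v | Y v ≤ c} ↔
      ∀ Q ∈ B, (Q : Measure E).real {v | c < Y v} ≤ ε := by
  rw [le_iInf₂_iff]
  refine forall₂_congr fun Q _ => ?_
  have hm : MeasurableSet {v | Y v ≤ c} := measurableSet_le hY measurable_const
  have h : {v | c < Y v} = {v | Y v ≤ c}ᶜ := by ext; simp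
  rw [ENNReal.ofReal_le_iff_le_toReal (measure_ne_top _ _), h, probReal_compl_eq_one_sub hm,
    measureReal_def]
  constructor <;> intro <;> linarith

theorem self_mem_wassersteinBall {E : Type*} [AddCommGroup E] [MeasurableSpace E]
    [MeasurableSub₂ E] {N : E → ℝ} (hN : Measurable N) (h0 : N 0 = 0) (P : ProbabilityMeasure E)
    (δ : ℝ) : P ∈ wassersteinBall N (P : Measure E) δ := by
  have hπ : IsCoupling ((P : Measure E).map fun v => (v, v)) P P :=
    ⟨(Measure.fst_map_prodMk measurable_id).trans Measure.map_id',
      (Measure.snd_map_prodMk measurable_id).trans Measure.map_id'⟩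
  refine (wassersteinDist_le N hπ).trans ?_
  have hNm : Measurable fun z : E × E => N (z.1 - z.2) :=
    hN.comp (measurable_fst.sub measurable_snd)
  rw [lintegral_map hNm.ennreal_ofReal (measurable_id'.prodMk measurable_id')]
  simp [h0]

/-! ### Whitening of the multivariate Gaussian -/

section Whitening

variable {m : ℕ} {S : Matrix (Fin m) (Fin m) ℝ}

/-- The square root of `S` acting on Euclidean space. -/
noncomputable def sqrtCLM (S : Matrix (Fin m) (Fin m) ℝ) :
    EuclideanSpace ℝ (Fin m) →L[ℝ] EuclideanSpace ℝ (Fin m) :=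
  Matrix.toEuclideanCLM (𝕜 := ℝ) (CFC.sqrt S)

theorem inner_sqrtCLM (v w : EuclideanSpace ℝ (Fin m)) :
    inner ℝ (sqrtCLM S v) w = inner ℝ v (sqrtCLM S w) := by
  have h : IsSelfAdjoint (sqrtCLM S) := (CFC.sqrt_nonneg S).isSelfAdjoint.map _
  rw [← ContinuousLinearMap.adjoint_inner_right, h.adjoint_eq]

theorem isUnit_sqrt (hS : S.PosDef) : IsUnit (CFC.sqrt S).det := by
  rw [← Matrix.isUnit_iff_isUnit_det, CFC.isUnit_sqrt_iff _ hS.posSemidef.nonneg]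
  exact hS.isUnit

theorem toEuclideanCLM_inv_sqrtCLM (hS : S.PosDef) (v : EuclideanSpace ℝ (Fin m)) :
    Matrix.toEuclideanCLM (𝕜 := ℝ) (CFC.sqrt S)⁻¹ (sqrtCLM S v) = v := by
  rw [sqrtCLM, ← mul_apply_eq_comp, ← map_mul,
    Matrix.nonsing_inv_mul _ (isUnit_sqrt hS)]
  simp

theorem sqrtCLM_toEuclideanCLM_inv (hS : S.PosDef) (v : EuclideanSpace ℝ (Fin m)) :
    sqrtCLM S (Matrix.toEuclideanCLM (𝕜 := ℝ) (CFC.sqrt S)⁻¹ v) = v := by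
  rw [sqrtCLM, ← mul_apply_eq_comp, ← map_mul,
    Matrix.mul_nonsing_inv _ (isUnit_sqrt hS)]
  simp

theorem measurable_whitenedNorm : Measurable (whitenedNorm S) := by
  unfold whitenedNorm
  fun_prop

theorem inner_le_norm_mul_whitenedNorm (hS : S.PosDef) (w v : EuclideanSpace ℝ (Fin m)) :
    inner ℝ w v ≤ ‖sqrtCLM S w‖ * whitenedNorm S v := by
  conv_lhs => rw [← sqrtCLM_toEuclideanCLM_inv hS v, ← inner_sqrtCLM]
  exact real_inner_le_norm _ _

/-- The Gaussian is the image of the standard one under `x ↦ μ + Σ^{1/2} x`. Self-adjointness turns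
the centred functional into `x ↦ ⟪Σ^{1/2} w, x⟫`, of variance `‖Σ^{1/2} w‖²`. -/
theorem map_inner_multivariateGaussian (μ : EuclideanSpace ℝ (Fin m))
    {w : EuclideanSpace ℝ (Fin m)} (hw : ‖sqrtCLM S w‖ ≠ 0) :
    (multivariateGaussian μ S).map
      (fun ξ => (inner ℝ w ξ - inner ℝ w μ) / ‖sqrtCLM S w‖) = gaussianReal 0 1 := by
  set L := innerSL ℝ (sqrtCLM S w) with hL
  have h1 : (stdGaussian (EuclideanSpace ℝ (Fin m))).map L =
      gaussianReal 0 (‖sqrtCLM S w‖ ^ 2).toNNReal := by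
    rw [IsGaussian.map_eq_gaussianReal, integral_strongDual_stdGaussian,
      variance_dual_stdGaussian, hL, innerSL_apply_norm]
  rw [multivariateGaussian, Measure.map_map (by fun_prop) (by fun_prop)]
  have h2 : (fun ξ => (inner ℝ w ξ - inner ℝ w μ) / ‖sqrtCLM S w‖) ∘
      (fun x => μ + Matrix.toEuclideanCLM (𝕜 := ℝ) (CFC.sqrt S) x) =
      (fun y => y / ‖sqrtCLM S w‖) ∘ L := by
    ext x
    simp only [Function.comp, hL, innerSL_apply_apply, inner_sqrtCLM, inner_add_right,
      add_sub_cancel_left]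
    rfl
  rw [h2, ← Measure.map_map (by fun_prop) (by fun_prop), h1, gaussianReal_map_div_const]
  congr 1
  · simp
  · ext
    simp [hw]

end Whitening

end DRCC

/-! ### The main theorem -/

theorem mainTheorem1 {n m : ℕ}
    (a : EuclideanSpace ℝ (Fin n) →ᵃ[ℝ] EuclideanSpace ℝ (Fin m))
    (b : EuclideanSpace ℝ (Fin n) →ᵃ[ℝ] ℝ)
    (μ : EuclideanSpace ℝ (Fin m)) (S : Matrix (Fin m) (Fin m) ℝ) (hS : S.PosDef)
    (δ : ℝ) (hδ : 0 < δ) (ε : ℝ) (hε : ε ∈ Set.Ioc (0 : ℝ) (1 / 2)) :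
    IsGLB (DRCC.pessRatios δ ε) (DRCC.pessConst δ ε) ∧
    0 ≤ DRCC.pessConst δ ε ∧
    DRCC.pessFeasible
        (DRCC.wassersteinBall (DRCC.whitenedNorm S) (multivariateGaussian μ S) δ) a b ε =
      {x | inner ℝ (a x) μ +
        DRCC.pessConst δ ε * ‖Matrix.toEuclideanCLM (𝕜 := ℝ) (CFC.sqrt S) (a x)‖ ≤ b x} := by
  obtain ⟨h0, hε⟩ := hε
  refine ⟨DRCC.isGLB_pessConst hδ h0 hε, DRCC.pessConst_nonneg hδ h0 hε, ?_⟩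
  ext x
  rw [DRCC.pessFeasible, Set.mem_ofPred_eq, Set.mem_ofPred_eq]
  change _ ↔ inner ℝ (a x) μ + DRCC.pessConst δ ε * ‖DRCC.sqrtCLM S (a x)‖ ≤ b x
  rw [DRCC.ofReal_le_iInf_iff (Y := fun ξ => inner ℝ (a x) ξ) (by fun_prop)]
  generalize a x = w
  generalize b x = β
  have hN := DRCC.measurable_whitenedNorm (S := S)
  rcases (norm_nonneg (DRCC.sqrtCLM S w)).eq_or_lt with hs | hs
  -- Degenerate case: both sides reduce to `0 ≤ β`. If `β < 0`, the reference law itself, which lies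
  -- in the ball, violates the constraint with probability `1 > ε`.
  · have hw : w = 0 := by
      rw [← DRCC.toEuclideanCLM_inv_sqrtCLM hS w, norm_eq_zero.1 hs.symm, map_zero]
    subst hw
    simp only [inner_zero_left, map_zero, norm_zero, mul_zero, add_zero]
    refine ⟨fun h => ?_, fun h Q _ => by simp [h.not_gt, h0.le]⟩
    by_contra! hβ
    have := h ⟨multivariateGaussian μ S, inferInstance⟩ (DRCC.self_mem_wassersteinBall hN
      (by simp [DRCC.whitenedNorm]) ⟨multivariateGaussian μ S, inferInstance⟩ δ)
    simp [hβ] at this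
    linarith
  · set s := ‖DRCC.sqrtCLM S w‖ with hsdef
    -- The vector `u = Σ w / s` is the equality direction of Cauchy–Schwarz: it has whitened norm
    -- one and `⟪w, u⟫ = s`.
    set u : EuclideanSpace ℝ (Fin m) := s⁻¹ • DRCC.sqrtCLM S (DRCC.sqrtCLM S w) with hu
    have hset : ∀ v : EuclideanSpace ℝ (Fin m),
        β < inner ℝ w v ↔ (β - inner ℝ w μ) / s < (inner ℝ w v - inner ℝ w μ) / s := fun v => by
      rw [div_lt_div_iff_of_pos_right hs, sub_lt_sub_iff_right]
    have hNu : ∀ t : ℝ, 0 ≤ t → DRCC.whitenedNorm S (t • u) = t := fun t ht => by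
      rw [DRCC.whitenedNorm, hu, map_smul, map_smul, DRCC.toEuclideanCLM_inv_sqrtCLM hS,
        norm_smul, norm_smul, ← hsdef, norm_inv, Real.norm_of_nonneg hs.le,
        inv_mul_cancel₀ hs.ne', Real.norm_of_nonneg ht, mul_one]
    have hwu : inner ℝ w u = s := by
      rw [hu, inner_smul_right, ← DRCC.inner_sqrtCLM, real_inner_self_eq_norm_sq, ← hsdef]
      field_simp
    simp_rw [hset]
    rw [DRCC.forall_mem_ball_iff hN (fun v => norm_nonneg _) (by fun_prop) (fun v v' => ?_)
      hNu (fun v t => ?_) (DRCC.map_inner_multivariateGaussian μ hs.ne') hδ h0 hε,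
      le_div_iff₀ hs, le_sub_iff_add_le']
    · rw [← sub_div, sub_sub_sub_cancel_right, ← inner_sub_right, div_le_iff₀' hs]
      exact DRCC.inner_le_norm_mul_whitenedNorm hS _ _
    · rw [inner_add_right, inner_smul_right, hwu, ← hsdef]
      field_simp
      ring
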